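/- Let $\mathcal L$ be a many-sorted language of continuous logic (each sort $S$ has a metric symbol bounded by some $M_S>0$; function and relation symbols come with uniform continuity moduli; each relation symbol $R$ takes values in a compact interval $K_R$; the connectives are all uniformly continuous functions $\mathbb R^k\to\mathbb R$; the quantifiers are $\sup$ and $\inf$ over a sort). Let $T$ be an $\mathcal L$-theory, i.e. a set of sentences, where $M\models T$ means that $\varphi^M=0$ for all $\varphi\in T$; metric structures have nonempty sorts. Let $\bar x$ be a finite tuple of variables. Let $\mathcal P^{\bar x}=\mathcal P^{\bar x}_T$ be the real Banach algebra of definable predicates: the completion of the space of formulas $\varphi(\bar x)$ (modulo formulas of norm $0$) for $\|\varphi\|=\sup\{|\varphi^M(\bar a)| : M\models T,\ \bar a\in M^{\bar x}\}$, with pointwise operations; equivalently, the algebra of all uniform limits of formulas over all models of $T$. A set $\pi\subseteq\mathcal P^{\bar x}$ is consistent (a partial type) if there are $M\models T$ and a tuple $\bar a\in M^{\bar x}$ with $P(\bar a)=0$ for all $P\in\pi$; a complete type is a maximal consistent set. **Theorem.** A linear functional $\hat p:\mathcal P^{\bar x}\to\mathbb R$ is a (continuous, unital) Banach-algebra homomorphism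 if and only if $\hat p(\mathbf 1)=1$ and its kernel $\{P\in\mathcal P^{\bar x} : \hat p(P)=0\}$ is a complete type. -/

import Mathlib

open scoped BoundedContinuousFunction

universe u

/-- A many-sorted language of continuous logic. Each sort `s` carries a metric symbol bounded by
`bound s > 0`; function and relation symbols come with uniform continuity moduli, and a relation
symbol `R` takes its values in the compact interval `[lo R, hi R]`. -/
structure MetricLanguage where
  Sorts : Type u
  bound : Sorts → ℝ
  bound_pos : ∀ s, 0 < bound s
  Func : Type u
  funcArity : Func → ℕ
  funcDom : ∀ f, Fin (funcArity f) → Sorts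
  funcRng : Func → Sorts
  funcMod : ∀ f, Fin (funcArity f) → ℝ → ℝ
  funcMod_pos : ∀ f i ε, 0 < ε → 0 < funcMod f i ε
  Rel : Type u
  relArity : Rel → ℕ
  relDom : ∀ R, Fin (relArity R) → Sorts
  lo : Rel → ℝ
  hi : Rel → ℝ
  lo_le_hi : ∀ R, lo R ≤ hi R
  relMod : ∀ R, Fin (relArity R) → ℝ → ℝ
  relMod_pos : ∀ R i ε, 0 < ε → 0 < relMod R i ε

namespace MetricLanguage

/-- Terms in a tuple of variables of sorts `σ 0, …, σ (n - 1)`, indexed by their range sort. -/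
inductive Term (L : MetricLanguage.{u}) {n : ℕ} (σ : Fin n → L.Sorts) : L.Sorts → Type u
  | var (i : Fin n) : Term L σ (σ i)
  | func (f : L.Func) (ts : ∀ i, Term L σ (L.funcDom f i)) : Term L σ (L.funcRng f)

/-- Formulas whose free variables are among a tuple of variables of sorts `σ 0, …, σ (n - 1)`.
Connectives are all uniformly continuous functions `ℝᵏ → ℝ`. In `sup s φ` and `inf s φ` the
quantified variable is the first variable of `φ`; it has sort `s`. -/
inductive Formula (L : MetricLanguage.{u}) : {n : ℕ} → (Fin n → L.Sorts) → Type u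
  | rel {n : ℕ} {σ : Fin n → L.Sorts} (R : L.Rel) (ts : ∀ i, Term L σ (L.relDom R i)) :
      Formula L σ
  | dist {n : ℕ} {σ : Fin n → L.Sorts} (s : L.Sorts) (t₁ t₂ : Term L σ s) : Formula L σ
  | conn {n : ℕ} {σ : Fin n → L.Sorts} {k : ℕ} (f : (Fin k → ℝ) → ℝ) (hf : UniformContinuous f)
      (φ : Fin k → Formula L σ) : Formula L σ
  | sup {n : ℕ} {σ : Fin n → L.Sorts} (s : L.Sorts)
      (φ : Formula L (Fin.cons s σ : Fin (n + 1) → L.Sorts)) : Formula L σ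
  | inf {n : ℕ} {σ : Fin n → L.Sorts} (s : L.Sorts)
      (φ : Formula L (Fin.cons s σ : Fin (n + 1) → L.Sorts)) : Formula L σ

/-- Metric structures: every sort is a nonempty metric space of diameter at most `bound s`, and the
symbols are interpreted by functions that respect the uniform continuity moduli. -/
structure MetricStructure (L : MetricLanguage.{u}) where
  carrier : L.Sorts → Type u
  [metric : ∀ s, MetricSpace (carrier s)]
  [nonempty : ∀ s, Nonempty (carrier s)]
  dist_le : ∀ (s : L.Sorts) (x y : carrier s), dist x y ≤ L.bound s
  func : ∀ f : L.Func, (∀ i, carrier (L.funcDom f i)) → carrier (L.funcRng f)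
  func_mod : ∀ (f : L.Func) (ε : ℝ), 0 < ε → ∀ x y : (∀ i, carrier (L.funcDom f i)),
    (∀ i, dist (x i) (y i) < L.funcMod f i ε) → dist (func f x) (func f y) ≤ ε
  rel : ∀ R : L.Rel, (∀ i, carrier (L.relDom R i)) → ℝ
  rel_mem : ∀ (R : L.Rel) (x : ∀ i, carrier (L.relDom R i)), rel R x ∈ Set.Icc (L.lo R) (L.hi R)
  rel_mod : ∀ (R : L.Rel) (ε : ℝ), 0 < ε → ∀ x y : (∀ i, carrier (L.relDom R i)),
    (∀ i, dist (x i) (y i) < L.relMod R i ε) → |rel R x - rel R y| ≤ ε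

attribute [instance] MetricStructure.metric MetricStructure.nonempty

variable {L : MetricLanguage.{u}}

/-- The value of a term at a tuple of a metric structure. -/
def Term.eval (M : L.MetricStructure) {n : ℕ} {σ : Fin n → L.Sorts}
    (a : ∀ i, M.carrier (σ i)) : {s : L.Sorts} → L.Term σ s → M.carrier s
  | _, .var i => a i
  | _, .func f ts => M.func f (fun i => (ts i).eval M a)

/-- The tuple `(b, a)`, where `b` has sort `s`. -/
def MetricStructure.consTuple (M : L.MetricStructure) {n : ℕ} {σ : Fin n → L.Sorts} {s : L.Sorts}
    (b : M.carrier s) (a : ∀ i, M.carrier (σ i)) :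
    ∀ i, M.carrier ((Fin.cons s σ : Fin (n + 1) → L.Sorts) i) :=
  Fin.cons (α := fun i => M.carrier ((Fin.cons s σ : Fin (n + 1) → L.Sorts) i)) b a

/-- The value `φ^M(a)` of a formula at a tuple of a metric structure. -/
noncomputable def Formula.eval (M : L.MetricStructure) : {n : ℕ} → {σ : Fin n → L.Sorts} →
    L.Formula σ → (∀ i, M.carrier (σ i)) → ℝ
  | _, _, .rel R ts, a => M.rel R (fun i => (ts i).eval M a)
  | _, _, .dist _ t₁ t₂, a => Dist.dist (t₁.eval M a) (t₂.eval M a)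
  | _, _, .conn f _ φ, a => f (fun j => (φ j).eval M a)
  | _, _, .sup s φ, a => ⨆ b : M.carrier s, φ.eval M (M.consTuple b a)
  | _, _, .inf s φ, a => ⨅ b : M.carrier s, φ.eval M (M.consTuple b a)

/-- Every formula is bounded, uniformly over all metric structures. -/
theorem Formula.exists_bound {n : ℕ} {σ : Fin n → L.Sorts} (φ : L.Formula σ) :
    ∃ B : ℝ, 0 ≤ B ∧ ∀ (M : L.MetricStructure) (a : ∀ i, M.carrier (σ i)), |φ.eval M a| ≤ B := by
  induction φ with
  | rel R ts =>
    refine ⟨max |L.lo R| |L.hi R|, le_max_of_le_left (abs_nonneg _), fun M a => ?_⟩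
    have h := M.rel_mem R (fun i => (ts i).eval M a)
    exact abs_le_max_abs_abs h.1 h.2
  | dist s t₁ t₂ =>
    refine ⟨L.bound s, (L.bound_pos s).le, fun M a => ?_⟩
    simp only [Formula.eval]
    rw [abs_of_nonneg dist_nonneg]
    exact M.dist_le _ _ _
  | @conn n σ k f hf φ ih =>
    choose B hB0 hB using ih
    have hc : IsCompact (Set.pi Set.univ fun j : Fin k => Set.Icc (-B j) (B j)) :=
      isCompact_univ_pi fun j => isCompact_Icc
    obtain ⟨C, hC⟩ := hc.exists_bound_of_continuousOn hf.continuous.continuousOn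
    refine ⟨max C 0, le_max_right _ _, fun M a => le_max_of_le_left ?_⟩
    exact hC _ fun j _ => abs_le.1 (hB j M a)
  | sup s φ ih =>
    obtain ⟨B, hB0, hB⟩ := ih
    refine ⟨B, hB0, fun M a => abs_le.2 ⟨?_, ?_⟩⟩
    · exact le_ciSup_of_le ⟨B, by rintro _ ⟨b, rfl⟩; exact (abs_le.1 (hB M _)).2⟩
        (Classical.arbitrary _) (abs_le.1 (hB M _)).1
    · exact ciSup_le fun b => (abs_le.1 (hB M _)).2
  | inf s φ ih =>
    obtain ⟨B, hB0, hB⟩ := ih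
    refine ⟨B, hB0, fun M a => abs_le.2 ⟨?_, ?_⟩⟩
    · exact le_ciInf fun b => (abs_le.1 (hB M _)).1
    · exact ciInf_le_of_le ⟨-B, by rintro _ ⟨b, rfl⟩; exact (abs_le.1 (hB M _)).1⟩
        (Classical.arbitrary _) (abs_le.1 (hB M _)).2

/-- Sentences are formulas without free variables. -/
abbrev Sentence (L : MetricLanguage.{u}) : Type u := L.Formula (Fin.elim0 : Fin 0 → L.Sorts)

/-- A theory is a set of sentences. -/
abbrev Theory (L : MetricLanguage.{u}) : Type u := Set L.Sentence

/-- `M ⊨ T`: every sentence of `T` has the value `0` in `M`. -/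
def MetricStructure.IsModel (M : L.MetricStructure) (T : L.Theory) : Prop :=
  ∀ φ ∈ T, φ.eval M (fun i => i.elim0) = 0

/-- Pairs `(M, a)` of a model `M` of `T` and a tuple `a` of `M` of sorts `σ`. -/
structure Point (T : L.Theory) {n : ℕ} (σ : Fin n → L.Sorts) where
  model : L.MetricStructure
  isModel : model.IsModel T
  tuple : ∀ i, model.carrier (σ i)

/-- The discrete topology, so that `Point T σ →ᵇ ℝ` is the algebra of all bounded real functions
on the pairs `(M, a)`, with the supremum norm. -/
instance (T : L.Theory) {n : ℕ} (σ : Fin n → L.Sorts) : TopologicalSpace (Point T σ) := ⊥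

instance (T : L.Theory) {n : ℕ} (σ : Fin n → L.Sorts) : DiscreteTopology (Point T σ) := ⟨rfl⟩

/-- The function `(M, a) ↦ φ^M(a)` on the tuples of models of `T`. Its norm is
`sup {|φ^M(a)| : M ⊨ T, a ∈ M^σ}`. -/
noncomputable def Formula.toFun (T : L.Theory) {n : ℕ} {σ : Fin n → L.Sorts} (φ : L.Formula σ) :
    Point T σ →ᵇ ℝ :=
  BoundedContinuousFunction.ofNormedAddCommGroupDiscrete (fun x => φ.eval x.model x.tuple)
    φ.exists_bound.choose (fun x => φ.exists_bound.choose_spec.2 x.model x.tuple)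

theorem Formula.toFun_apply (T : L.Theory) {n : ℕ} {σ : Fin n → L.Sorts} (φ : L.Formula σ)
    (x : Point T σ) : φ.toFun T x = φ.eval x.model x.tuple := rfl

theorem uniformContinuous_clamp_mul (A B : ℝ) (hA : -A ≤ A) (hB : -B ≤ B) :
    UniformContinuous fun x : Fin 2 → ℝ =>
      (Set.projIcc (-A) A hA (x 0) : ℝ) * (Set.projIcc (-B) B hB (x 1) : ℝ) := by
  have h : UniformContinuous fun q : Set.Icc (-A) A × Set.Icc (-B) B => (q.1 : ℝ) * (q.2 : ℝ) :=
    CompactSpace.uniformContinuous_of_continuous (by fun_prop)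
  have h0 : UniformContinuous fun x : Fin 2 → ℝ => Set.projIcc (-A) A hA (x 0) :=
    (LipschitzWith.projIcc hA).uniformContinuous.comp (Pi.uniformContinuous_proj _ 0)
  have h1 : UniformContinuous fun x : Fin 2 → ℝ => Set.projIcc (-B) B hB (x 1) :=
    (LipschitzWith.projIcc hB).uniformContinuous.comp (Pi.uniformContinuous_proj _ 1)
  exact h.comp (h0.prodMk h1)

/-- The functions given by formulas, that is, the quotient of the space of formulas by the
formulas of norm `0` modulo `T`. -/
noncomputable def formulaAlgebra (T : L.Theory) {n : ℕ} (σ : Fin n → L.Sorts) :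
    Subalgebra ℝ (Point T σ →ᵇ ℝ) where
  carrier := Set.range (Formula.toFun T)
  add_mem' := by
    rintro _ _ ⟨φ, rfl⟩ ⟨ψ, rfl⟩
    refine ⟨.conn (fun x : Fin 2 → ℝ => x 0 + x 1)
      ((Pi.uniformContinuous_proj _ 0).add (Pi.uniformContinuous_proj _ 1)) ![φ, ψ], ?_⟩
    ext x
    simp [Formula.toFun_apply, Formula.eval]
  mul_mem' := by
    rintro _ _ ⟨φ, rfl⟩ ⟨ψ, rfl⟩
    obtain ⟨A, hA0, hA⟩ := φ.exists_bound
    obtain ⟨B, hB0, hB⟩ := ψ.exists_bound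
    refine ⟨.conn _ (uniformContinuous_clamp_mul A B (by linarith) (by linarith)) ![φ, ψ], ?_⟩
    ext x
    have h0 := abs_le.1 (hA x.model x.tuple)
    have h1 := abs_le.1 (hB x.model x.tuple)
    simp [Formula.toFun_apply, Formula.eval, Set.coe_projIcc, h0.1, h0.2, h1.1, h1.2]
  algebraMap_mem' r := by
    refine ⟨.conn (fun _ : Fin 0 → ℝ => r) uniformContinuous_const Fin.elim0, ?_⟩
    ext x
    simp [Formula.toFun_apply, Formula.eval, BoundedContinuousFunction.algebraMap_apply]

/-- The Banach algebra of definable predicates of `T` in a tuple of variables of sorts `σ`: the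
completion of the space of formulas, realized as the algebra of all uniform limits, over all models
of `T`, of formulas, with the pointwise operations and the supremum norm. -/
noncomputable def definablePredicates (T : L.Theory) {n : ℕ} (σ : Fin n → L.Sorts) :
    Subalgebra ℝ (Point T σ →ᵇ ℝ) :=
  (formulaAlgebra T σ).topologicalClosure

instance (T : L.Theory) {n : ℕ} (σ : Fin n → L.Sorts) :
    CompleteSpace (definablePredicates T σ) :=
  (Subalgebra.isClosed_topologicalClosure (formulaAlgebra T σ)).completeSpace_coe

/-- A set of definable predicates is consistent (a partial type) if some tuple of some model of `T`
is a common zero of its members. -/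
def IsPartialType {T : L.Theory} {n : ℕ} {σ : Fin n → L.Sorts}
    (π : Set (definablePredicates T σ)) : Prop :=
  ∃ x : Point T σ, ∀ P ∈ π, (P : Point T σ →ᵇ ℝ) x = 0

/-- A complete type is a maximal consistent set of definable predicates. -/
def IsCompleteType {T : L.Theory} {n : ℕ} {σ : Fin n → L.Sorts}
    (π : Set (definablePredicates T σ)) : Prop :=
  Maximal IsPartialType π

end MetricLanguage

open Filter Topology

namespace MetricLanguage

variable {L : MetricLanguage.{u}}

/-! Both conditions on `p` say that `p` is evaluation at a point `(M, a)` with `M ⊨ T`. If `p 1 = 1`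
and the kernel has a common zero `x`, then `P - p P • 1` lies in the kernel, so `P x = p P`;
evaluations are characters. This also gives maximality: a realization of a consistent set containing
the kernel evaluates to `p` again.

The substantial direction is that every character is such an evaluation
(`exists_point_of_character`). A predicate in the kernel cannot be bounded below by a positive
constant, since characters are contractive. Applied to a sum of squares of `φ - Φ φ`, this realizes
the values of `Φ` on finitely many formulas up to any `ε`. Compactness, proved by metric
ultraproducts and Łoś's theorem, yields one point realizing all of them exactly, and density of
formulas extends this to all definable predicates. -/

theorem exists_tendsto_of_mem_Icc {ι : Type*} (U : Ultrafilter ι) {f : ι → ℝ} {a b : ℝ}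
    (h : ∀ i, f i ∈ Set.Icc a b) : ∃ x ∈ Set.Icc a b, Tendsto f U (𝓝 x) := by
  obtain ⟨x, hx, hle⟩ := (isCompact_Icc (a := a) (b := b)).ultrafilter_le_nhds' (U.map f)
    (Ultrafilter.mem_map.2 (Filter.univ_mem' h))
  exact ⟨x, hx, hle⟩

/-- The tuples of elements of a sort in a family of metric structures, as a pseudometric space in
which distances are limits of distances along an ultrafilter. -/
def PreUltraproduct {ι : Type u} (_U : Ultrafilter ι) (M : ι → L.MetricStructure)
    (s : L.Sorts) : Type u :=
  ∀ i, (M i).carrier s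

/-! ### The limit pseudometric along an ultrafilter. -/

namespace PreUltraproduct

variable {ι : Type u} {U : Ultrafilter ι} {M : ι → L.MetricStructure} {s : L.Sorts}

theorem exists_tendsto_dist (x y : PreUltraproduct U M s) :
    ∃ d ∈ Set.Icc 0 (L.bound s), Tendsto (fun i => dist (x i) (y i)) U (𝓝 d) :=
  exists_tendsto_of_mem_Icc U fun i => ⟨dist_nonneg, (M i).dist_le s _ _⟩

noncomputable instance : Dist (PreUltraproduct U M s) :=
  ⟨fun x y => (exists_tendsto_dist x y).choose⟩

theorem dist_le_bound (x y : PreUltraproduct U M s) : dist x y ≤ L.bound s :=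
  (exists_tendsto_dist x y).choose_spec.1.2

theorem tendsto_dist (x y : PreUltraproduct U M s) :
    Tendsto (fun i => dist (x i) (y i)) U (𝓝 (dist x y)) :=
  (exists_tendsto_dist x y).choose_spec.2

noncomputable instance : PseudoMetricSpace (PreUltraproduct U M s) where
  dist_self x := tendsto_nhds_unique (tendsto_dist x x) (by simp)
  dist_comm x y := tendsto_nhds_unique (tendsto_dist x y) (by
    simpa only [dist_comm] using tendsto_dist y x)
  dist_triangle x y z := le_of_tendsto_of_tendsto' (tendsto_dist x z)
    ((tendsto_dist x y).add (tendsto_dist y z)) fun i => dist_triangle _ _ _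

instance : Nonempty (PreUltraproduct U M s) :=
  inferInstanceAs (Nonempty (∀ i, (M i).carrier s))

end PreUltraproduct

/-! ### Metric ultraproducts and Łoś's theorem. -/

section Ultraproduct

variable {ι : Type u} {U : Ultrafilter ι} {M : ι → L.MetricStructure}

/-- A strict bound on a limit already holds on a set of the ultrafilter, and finitely many such sets
can be intersected. This transfers the strict hypotheses of the moduli to the factors; their weak
conclusions then survive the limit. -/
theorem eventually_forall_dist_lt {k : ℕ} {τ : Fin k → L.Sorts} {δ : Fin k → ℝ}
    {x y : ∀ j, PreUltraproduct U M (τ j)} (h : ∀ j, dist (x j) (y j) < δ j) :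
    ∀ᶠ i in (U : Filter ι), ∀ j, dist (x j i) (y j i) < δ j :=
  eventually_all.2 fun j =>
    (PreUltraproduct.tendsto_dist (x j) (y j)).eventually_lt_const (h j)

theorem dist_funcs_le (f : L.Func) {ε : ℝ} (hε : 0 < ε)
    {x y : ∀ j, PreUltraproduct U M (L.funcDom f j)}
    (h : ∀ j, dist (x j) (y j) < L.funcMod f j ε) :
    dist (show PreUltraproduct U M (L.funcRng f) from fun i => (M i).func f fun j => x j i)
      (show PreUltraproduct U M (L.funcRng f) from fun i => (M i).func f fun j => y j i) ≤ ε :=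
  le_of_tendsto (PreUltraproduct.tendsto_dist _ _) <|
    (eventually_forall_dist_lt h).mono fun i hi => (M i).func_mod f ε hε _ _ hi

theorem exists_tendsto_rel (U : Ultrafilter ι) (M : ι → L.MetricStructure) (R : L.Rel)
    (x : ∀ j, PreUltraproduct U M (L.relDom R j)) :
    ∃ r ∈ Set.Icc (L.lo R) (L.hi R),
      Tendsto (fun i => (M i).rel R fun j => x j i) U (𝓝 r) :=
  exists_tendsto_of_mem_Icc U fun i => (M i).rel_mem R _

theorem abs_sub_le_of_tendsto_rel (R : L.Rel) {ε : ℝ} (hε : 0 < ε)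
    {x y : ∀ j, PreUltraproduct U M (L.relDom R j)}
    (h : ∀ j, dist (x j) (y j) < L.relMod R j ε) {r t : ℝ}
    (hr : Tendsto (fun i => (M i).rel R fun j => x j i) U (𝓝 r))
    (ht : Tendsto (fun i => (M i).rel R fun j => y j i) U (𝓝 t)) : |r - t| ≤ ε :=
  le_of_tendsto (hr.sub ht).abs <|
    (eventually_forall_dist_lt h).mono fun i hi => (M i).rel_mod R ε hε _ _ hi

theorem dist_out (s : L.Sorts) (x y : SeparationQuotient (PreUltraproduct U M s)) :
    dist (α := PreUltraproduct U M s) (Quotient.out x) (Quotient.out y) = dist x y := by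
  rw [← SeparationQuotient.dist_mk]
  exact congrArg₂ dist (Quotient.out_eq x) (Quotient.out_eq y)

theorem dist_out_mk {s : L.Sorts} (x : PreUltraproduct U M s) :
    dist (Quotient.out (SeparationQuotient.mk x)) x = 0 := by
  rw [← SeparationQuotient.dist_mk]
  exact (congrArg (dist · (SeparationQuotient.mk x))
    (Quotient.out_eq (SeparationQuotient.mk x))).trans (dist_self (SeparationQuotient.mk x))

/-- The metric ultraproduct of a family of metric structures. -/
noncomputable def ultraproduct (U : Ultrafilter ι) (M : ι → L.MetricStructure) :
    L.MetricStructure where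
  carrier s := SeparationQuotient (PreUltraproduct U M s)
  nonempty s := ⟨SeparationQuotient.mk (Classical.arbitrary _)⟩
  dist_le s x y := by
    rw [← dist_out]
    exact PreUltraproduct.dist_le_bound _ _
  func f x := SeparationQuotient.mk
    (show PreUltraproduct U M (L.funcRng f) from fun i => (M i).func f fun j => (x j).out i)
  func_mod f ε hε x y h := by
    rw [SeparationQuotient.dist_mk]
    exact dist_funcs_le f hε fun j => (dist_out _ _ _).trans_lt (h j)
  rel R x := (exists_tendsto_rel U M R fun j => (x j).out).choose
  rel_mem R x := (exists_tendsto_rel U M R fun j => (x j).out).choose_spec.1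
  rel_mod R ε hε x y h :=
    abs_sub_le_of_tendsto_rel R hε (fun j => (dist_out _ _ _).trans_lt (h j))
      (exists_tendsto_rel U M R fun j => (x j).out).choose_spec.2
      (exists_tendsto_rel U M R fun j => (y j).out).choose_spec.2

/-- The element of the ultraproduct given by a family of elements. -/
noncomputable def ultraproductMk (U : Ultrafilter ι) {M : ι → L.MetricStructure} {s : L.Sorts}
    (x : ∀ i, (M i).carrier s) : (ultraproduct U M).carrier s :=
  SeparationQuotient.mk (show PreUltraproduct U M s from x)

theorem ultraproductMk_surjective {s : L.Sorts} (b : (ultraproduct U M).carrier s) :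
    ∃ x : ∀ i, (M i).carrier s, ultraproductMk U x = b :=
  SeparationQuotient.surjective_mk b

theorem ultraproduct_tendsto_dist {s : L.Sorts} (x y : ∀ i, (M i).carrier s) :
    Tendsto (fun i => dist (x i) (y i)) U
      (𝓝 (dist (ultraproductMk U x) (ultraproductMk U y))) :=
  PreUltraproduct.tendsto_dist (U := U) x y

/-- Independence of representatives: `Quotient.out` may return a family other than `x j`, but at
distance `0` from it, hence below every modulus; so the two values are within every `ε > 0`. -/
theorem ultraproduct_func (f : L.Func) (x : ∀ j, ∀ i, (M i).carrier (L.funcDom f j)) :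
    (ultraproduct U M).func f (fun j => ultraproductMk U (x j)) =
      ultraproductMk U fun i => (M i).func f fun j => x j i := by
  refine dist_le_zero.1 (le_of_forall_pos_le_add fun ε hε => ?_)
  rw [zero_add]
  refine dist_funcs_le (U := U) (M := M) f hε fun j => ?_
  exact (dist_out_mk (U := U) (M := M) (x j)).trans_lt (L.funcMod_pos f j ε hε)

theorem ultraproduct_tendsto_rel (R : L.Rel) (x : ∀ j, ∀ i, (M i).carrier (L.relDom R j)) :
    Tendsto (fun i => (M i).rel R fun j => x j i) U
      (𝓝 ((ultraproduct U M).rel R fun j => ultraproductMk U (x j))) := by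
  obtain ⟨r, -, hr⟩ := exists_tendsto_rel U M R x
  -- The symbol is interpreted through the representatives chosen by `out`; these are at distance
  -- `0` from `x`, so the moduli force the same limit.
  have h : |(ultraproduct U M).rel R (fun j => ultraproductMk U (x j)) - r| ≤ 0 := by
    refine le_of_forall_pos_le_add fun ε hε => ?_
    rw [zero_add]
    refine abs_sub_le_of_tendsto_rel R hε (fun j => ?_)
      (exists_tendsto_rel U M R fun j => (ultraproductMk U (x j)).out).choose_spec.2 hr
    exact (dist_out_mk (U := U) (M := M) (x j)).trans_lt (L.relMod_pos R j ε hε)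
  rwa [sub_eq_zero.1 (abs_nonpos_iff.1 h)]

theorem Term.eval_ultraproduct {n : ℕ} {σ : Fin n → L.Sorts}
    (a : ∀ j, ∀ i, (M i).carrier (σ j)) {s : L.Sorts} (t : L.Term σ s) :
    t.eval (ultraproduct U M) (fun j => ultraproductMk U (a j)) =
      ultraproductMk U fun i => t.eval (M i) fun j => a j i := by
  induction t with
  | var j => rfl
  | func f ts ih =>
    simp only [Term.eval, ih]
    exact ultraproduct_func f _

theorem consTuple_ultraproductMk {n : ℕ} {σ : Fin n → L.Sorts} {s : L.Sorts}
    (b : ∀ i, (M i).carrier s) (a : ∀ j, ∀ i, (M i).carrier (σ j)) :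
    (ultraproduct U M).consTuple (ultraproductMk U b) (fun j => ultraproductMk U (a j)) =
      fun j => ultraproductMk U fun i => (M i).consTuple (b i) (fun j => a j i) j := by
  funext j
  refine Fin.cases ?_ (fun j => ?_) j <;> rfl

theorem Formula.bddAbove_range_eval {n : ℕ} {σ : Fin n → L.Sorts} {s : L.Sorts}
    (φ : L.Formula (Fin.cons s σ : Fin (n + 1) → L.Sorts)) (N : L.MetricStructure)
    (a : ∀ i, N.carrier (σ i)) :
    BddAbove (Set.range fun b : N.carrier s => φ.eval N (N.consTuple b a)) := by
  obtain ⟨B, -, hB⟩ := φ.exists_bound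
  exact ⟨B, by rintro _ ⟨b, rfl⟩; exact (abs_le.1 (hB N _)).2⟩

theorem Formula.bddBelow_range_eval {n : ℕ} {σ : Fin n → L.Sorts} {s : L.Sorts}
    (φ : L.Formula (Fin.cons s σ : Fin (n + 1) → L.Sorts)) (N : L.MetricStructure)
    (a : ∀ i, N.carrier (σ i)) :
    BddBelow (Set.range fun b : N.carrier s => φ.eval N (N.consTuple b a)) := by
  obtain ⟨B, -, hB⟩ := φ.exists_bound
  exact ⟨-B, by rintro _ ⟨b, rfl⟩; exact (abs_le.1 (hB N _)).1⟩

theorem Formula.exists_tendsto_eval {n : ℕ} {σ : Fin n → L.Sorts} (φ : L.Formula σ)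
    (a : ∀ j, ∀ i, (M i).carrier (σ j)) :
    ∃ r, Tendsto (fun i => φ.eval (M i) fun j => a j i) U (𝓝 r) := by
  obtain ⟨B, -, hB⟩ := φ.exists_bound
  obtain ⟨r, -, hr⟩ := exists_tendsto_of_mem_Icc U fun i => abs_le.1 (hB (M i) fun j => a j i)
  exact ⟨r, hr⟩

/-- Łoś's theorem for metric ultraproducts. -/
theorem Formula.tendsto_eval_ultraproduct {n : ℕ} {σ : Fin n → L.Sorts} (φ : L.Formula σ)
    (a : ∀ j, ∀ i, (M i).carrier (σ j)) :
    Tendsto (fun i => φ.eval (M i) fun j => a j i) U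
      (𝓝 (φ.eval (ultraproduct U M) fun j => ultraproductMk U (a j))) := by
  induction φ with
  | rel R ts =>
    simp only [Formula.eval, Term.eval_ultraproduct]
    exact ultraproduct_tendsto_rel R _
  | dist s t₁ t₂ =>
    simp only [Formula.eval, Term.eval_ultraproduct]
    exact ultraproduct_tendsto_dist _ _
  | conn f hf φ ih =>
    exact (hf.continuous.tendsto _).comp (tendsto_pi_nhds.2 fun j => ih j a)
  | sup s φ ih =>
    have key (b : ∀ i, (M i).carrier s) := by
      simpa only [← consTuple_ultraproductMk] using
        ih fun j i => (M i).consTuple (b i) (fun j => a j i) j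
    obtain ⟨r, hr⟩ := (Formula.sup s φ).exists_tendsto_eval (U := U) a
    convert hr using 2
    apply le_antisymm
    · refine ciSup_le fun b => ?_
      obtain ⟨b, rfl⟩ := ultraproductMk_surjective b
      exact le_of_tendsto_of_tendsto' (key b) hr fun i =>
        le_ciSup (φ.bddAbove_range_eval (M i) _) (b i)
    · refine le_of_forall_pos_le_add fun ε hε => ?_
      -- Witnesses within `ε` of the supremum in each factor are assembled into a single element of
      -- the ultraproduct.
      choose b hb using fun i => exists_lt_of_lt_ciSup
        (sub_lt_self (⨆ b, φ.eval (M i) ((M i).consTuple b fun j => a j i)) hε)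
      refine (le_of_tendsto_of_tendsto' hr ((key b).add_const ε) fun i =>
        (sub_lt_iff_lt_add.1 (hb i)).le).trans ?_
      gcongr
      exact le_ciSup (φ.bddAbove_range_eval (ultraproduct U M) _) (ultraproductMk U b)
  | inf s φ ih =>
    have key (b : ∀ i, (M i).carrier s) := by
      simpa only [← consTuple_ultraproductMk] using
        ih fun j i => (M i).consTuple (b i) (fun j => a j i) j
    obtain ⟨r, hr⟩ := (Formula.inf s φ).exists_tendsto_eval (U := U) a
    convert hr using 2
    apply le_antisymm
    · refine le_of_forall_pos_le_add fun ε hε => ?_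
      choose b hb using fun i => exists_lt_of_ciInf_lt
        (lt_add_of_pos_right (⨅ b, φ.eval (M i) ((M i).consTuple b fun j => a j i)) hε)
      exact (ciInf_le (φ.bddBelow_range_eval (ultraproduct U M) _) (ultraproductMk U b)).trans
        (le_of_tendsto_of_tendsto' (key b) (hr.add_const ε) fun i => (hb i).le)
    · refine le_ciInf fun b => ?_
      obtain ⟨b, rfl⟩ := ultraproductMk_surjective b
      exact le_of_tendsto_of_tendsto' hr (key b) fun i =>
        ciInf_le (φ.bddBelow_range_eval (M i) _) (b i)

theorem isModel_ultraproduct {T : L.Theory} (h : ∀ i, (M i).IsModel T) :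
    (ultraproduct U M).IsModel T := by
  intro φ hφ
  have ht := φ.tendsto_eval_ultraproduct (U := U) (M := M) fun j => j.elim0
  rw [Subsingleton.elim (fun j => ultraproductMk U _) fun j : Fin 0 => j.elim0] at ht
  refine tendsto_nhds_unique ht (tendsto_const_nhds.congr fun i => ?_)
  rw [← h i φ hφ]
  congr 1
  exact Subsingleton.elim _ _

end Ultraproduct

/-! ### Compactness, and characters as evaluations. -/

section Predicates

variable {T : L.Theory} {n : ℕ} {σ : Fin n → L.Sorts}

/-- Compactness: approximate values on finite sets of formulas are realized exactly. -/
theorem exists_point_of_finitely_approximable (v : L.Formula σ → ℝ)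
    (h : ∀ (F : Finset (L.Formula σ)) (ε : ℝ), 0 < ε →
      ∃ x : Point T σ, ∀ φ ∈ F, |φ.toFun T x - v φ| ≤ ε) :
    ∃ x : Point T σ, ∀ φ : L.Formula σ, φ.toFun T x = v φ := by
  choose x hx using fun k : Finset (L.Formula σ) × ℕ =>
    h k.1 (1 / (k.2 + 1)) Nat.one_div_pos_of_nat
  classical
  -- Along an ultrafilter finer than `atTop`, each formula eventually belongs to the finite set and
  -- the tolerance `1 / (m + 1)` tends to `0`.
  let U : Ultrafilter (Finset (L.Formula σ) × ℕ) := Ultrafilter.of atTop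
  have hU : (U : Filter (Finset (L.Formula σ) × ℕ)) ≤ atTop := Ultrafilter.of_le _
  refine ⟨⟨ultraproduct U fun k => (x k).model, isModel_ultraproduct fun k => (x k).isModel,
    fun j => ultraproductMk U fun k => (x k).tuple j⟩, fun φ => ?_⟩
  refine tendsto_nhds_unique (φ.tendsto_eval_ultraproduct (U := U) fun j k => (x k).tuple j) ?_
  have hz : Tendsto (fun k : Finset (L.Formula σ) × ℕ => 1 / ((k.2 : ℝ) + 1)) U (𝓝 0) := by
    refine tendsto_one_div_add_atTop_nhds_zero_nat.comp (Tendsto.mono_left ?_ hU)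
    rw [← prod_atTop_atTop_eq]
    exact tendsto_snd
  refine tendsto_sub_nhds_zero_iff.1 (squeeze_zero_norm' ?_ hz)
  filter_upwards [hU (mem_atTop ({φ}, 0))] with k hk
  exact hx k φ (hk.1 (Finset.mem_singleton_self φ))

/-- A definable predicate that is bounded below by a positive constant is not in the kernel of a
character. -/
theorem exists_apply_lt_of_character_eq_zero
    (Φ : definablePredicates T σ →ₐ[ℝ] ℝ) (Q : definablePredicates T σ) (hQ : Φ Q = 0)
    {ε : ℝ} (hε : 0 < ε) :
    ∃ x, (Q : Point T σ →ᵇ ℝ) x < ε := by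
  by_contra! hc
  -- With this `C`, `ε ≤ Q ≤ C` gives `0 ≤ 1 - Q / C ≤ 1 - ε / C`, although `Φ` sends `1 - Q / C` to
  -- `1`. The summand `ε` keeps `C` positive.
  set C := ‖(Q : Point T σ →ᵇ ℝ)‖ + ε with hC
  have hC0 : 0 < C := by positivity
  have hnorm : ‖(1 - C⁻¹ • Q : definablePredicates T σ)‖ ≤ 1 - C⁻¹ * ε := by
    have hle : C⁻¹ * ε ≤ 1 := by
      rw [inv_mul_le_iff₀ hC0]
      linarith [norm_nonneg (Q : Point T σ →ᵇ ℝ)]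
    refine (BoundedContinuousFunction.norm_le (sub_nonneg.2 hle)).2 fun x => ?_
    have h1 : (Q : Point T σ →ᵇ ℝ) x ≤ C :=
      (le_abs_self _).trans (((Q : Point T σ →ᵇ ℝ).norm_coe_le_norm x).trans (by linarith))
    have h2 : C⁻¹ * (Q : Point T σ →ᵇ ℝ) x ≤ 1 := by rw [inv_mul_le_iff₀ hC0]; linarith
    have h3 : C⁻¹ * ε ≤ C⁻¹ * (Q : Point T σ →ᵇ ℝ) x := by gcongr; exact hc x
    change |1 - C⁻¹ * (Q : Point T σ →ᵇ ℝ) x| ≤ _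
    rw [abs_of_nonneg (by linarith)]
    linarith
  -- Only an inequality: if `T` has no models, then `1 = 0` in this algebra.
  have hone : ‖(1 : definablePredicates T σ)‖ ≤ 1 :=
    (BoundedContinuousFunction.norm_le zero_le_one).2 fun x => by simp
  have hΦ := AlgHom.norm_apply_le_self_mul_norm_one Φ (1 - C⁻¹ • Q)
  have hval : Φ (1 - C⁻¹ • Q) = 1 :=
    (map_sub Φ 1 (C⁻¹ • Q)).trans (by rw [map_one, map_smul, hQ, smul_zero, sub_zero])
  rw [hval, norm_one] at hΦ
  have hpos : 0 < C⁻¹ * ε := by positivity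
  nlinarith [norm_nonneg (1 - C⁻¹ • Q : definablePredicates T σ)]

/-- A formula as a definable predicate. -/
noncomputable def Formula.toPredicate (T : L.Theory) (φ : L.Formula σ) : definablePredicates T σ :=
  ⟨φ.toFun T, Subalgebra.le_topologicalClosure _ ⟨φ, rfl⟩⟩

theorem exists_point_of_character (Φ : definablePredicates T σ →A[ℝ] ℝ) :
    ∃ x : Point T σ, ∀ P : definablePredicates T σ, Φ P = (P : Point T σ →ᵇ ℝ) x := by
  obtain ⟨x, hx⟩ := exists_point_of_finitely_approximable (T := T)
    (fun φ : L.Formula σ => Φ (φ.toPredicate T)) fun F ε hε => by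
      -- Each `g φ` is in the kernel of `Φ`. A point where the sum of their squares is below `ε ^ 2`
      -- makes every `|g φ|` with `φ ∈ F` at most `ε`.
      let g (φ : L.Formula σ) : definablePredicates T σ :=
        φ.toPredicate T - algebraMap ℝ _ (Φ (φ.toPredicate T))
      have hval (y : Point T σ) : ((∑ φ ∈ F, g φ ^ 2 : definablePredicates T σ) :
          Point T σ →ᵇ ℝ) y = ∑ φ ∈ F, (φ.toFun T y - Φ (φ.toPredicate T)) ^ 2 := by
        rw [AddSubmonoidClass.coe_finsetSum, BoundedContinuousFunction.sum_apply]
        rfl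
      obtain ⟨y, hy⟩ := exists_apply_lt_of_character_eq_zero (Φ : _ →ₐ[ℝ] ℝ)
        (∑ φ ∈ F, g φ ^ 2) (by
          rw [map_sum]
          refine Finset.sum_eq_zero fun φ _ => ?_
          rw [map_pow, sq_eq_zero_iff]
          exact (map_sub Φ _ _).trans (sub_eq_zero.2 (AlgHomClass.commutes Φ _).symm))
        (pow_pos hε 2)
      rw [hval] at hy
      refine ⟨y, fun φ hφ => abs_le_of_sq_le_sq ?_ hε.le⟩
      exact (Finset.single_le_sum (f := fun φ => (φ.toFun T y - Φ (φ.toPredicate T)) ^ 2)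
        (fun _ _ => sq_nonneg _) hφ).trans hy.le
  -- Both `Φ` and evaluation at `x` are continuous and agree on formulas, which are dense.
  refine ⟨x, fun P => ?_⟩
  obtain ⟨P, hP⟩ := P
  obtain ⟨u, hu, hlim⟩ := mem_closure_iff_seq_limit.1 hP
  choose φ hφ using hu
  have hP' : Tendsto (fun k => (φ k).toPredicate T) atTop (𝓝 ⟨P, hP⟩) :=
    tendsto_subtype_rng.2 (by simpa only [Formula.toPredicate, hφ] using hlim)
  refine tendsto_nhds_unique ((Φ.continuous.tendsto _).comp hP') ?_
  refine (((continuous_eval_const x).tendsto P).comp hlim).congr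
    fun k => ?_
  simp only [Function.comp_apply, ← hφ, hx]

/-- Evaluation at a point, as a continuous character. -/
noncomputable def evalCharacter (x : Point T σ) : definablePredicates T σ →A[ℝ] ℝ where
  toFun P := (P : Point T σ →ᵇ ℝ) x
  map_one' := rfl
  map_mul' _ _ := rfl
  map_zero' := rfl
  map_add' _ _ := rfl
  commutes' r := by simp [BoundedContinuousFunction.algebraMap_apply]
  cont := (continuous_eval_const x).comp continuous_subtype_val

/-- A normalized linear functional whose kernel vanishes at a point is the evaluation there. -/
theorem apply_eq_of_ker_vanishes {p : definablePredicates T σ →ₗ[ℝ] ℝ} (h1 : p 1 = 1)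
    {x : Point T σ} (hx : ∀ P, p P = 0 → (P : Point T σ →ᵇ ℝ) x = 0)
    (P : definablePredicates T σ) : (P : Point T σ →ᵇ ℝ) x = p P := by
  have h : (P : Point T σ →ᵇ ℝ) x - p P * 1 = 0 := hx (P - p P • 1) <|
    (map_sub p P (p P • 1)).trans (by rw [map_smul, h1, smul_eq_mul, mul_one, sub_self])
  linarith

end Predicates

end MetricLanguage

theorem mainTheorem11 {L : MetricLanguage.{u}} (T : L.Theory) {n : ℕ} (σ : Fin n → L.Sorts)
    (p : MetricLanguage.definablePredicates T σ →ₗ[ℝ] ℝ) :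
    (∃ Φ : MetricLanguage.definablePredicates T σ →A[ℝ] ℝ, ∀ P, Φ P = p P) ↔
      p 1 = 1 ∧ MetricLanguage.IsCompleteType {P | p P = 0} := by
  constructor
  · rintro ⟨Φ, hΦ⟩
    have h1 : p 1 = 1 := by rw [← hΦ, map_one]
    obtain ⟨x, hx⟩ := MetricLanguage.exists_point_of_character Φ
    refine ⟨h1, ⟨x, fun P hP => ?_⟩, ?_⟩
    · rw [← hx, hΦ]
      exact hP
    -- Since `π` contains the kernel, the kernel vanishes at `y`, so `p` is also evaluation at `y`;
    -- hence `p` vanishes on `π`.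
    · rintro π ⟨y, hy⟩ hle P hP
      exact (MetricLanguage.apply_eq_of_ker_vanishes h1 (fun Q hQ => hy Q (hle hQ)) P).symm.trans
        (hy P hP)
  · rintro ⟨h1, ⟨x, hx⟩, -⟩
    exact ⟨MetricLanguage.evalCharacter x, MetricLanguage.apply_eq_of_ker_vanishes h1 hx⟩
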